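/- Let $k$ be a field, let $X$ be a reduced scheme of finite type over $k$, of pure dimension $n$, and let $L$ be a $\mathbb{Q}$-line bundle on $X$, i.e. an element of $\mathrm{Pic}(X)\otimes\mathbb{Q}$. A \emph{stratification} $\Sigma$ of $X$ is a sequence $X_0 \xrightarrow{f_0} X_1 \to \dots \xrightarrow{f_{n-1}} X_n \xrightarrow{q} X$, where each $X_i$ is a normal scheme of pure dimension $i$ (possibly empty), $q$ is proper and birational, and each $f_i$ factors as a proper birational morphism onto a reduced Weil divisor of $X_{i+1}$. Let $q_i : X_i \to X$ be the composite map, $U_i = X_i \setminus f_{i-1}(X_{i-1})$ for $i \geq 1$, and $U_0 = X_0$. A \emph{trivialized stratification} $\underline{\Sigma} = (\Sigma, \frac1d \mathbf{e})$ for $L$ consists of $\Sigma$, an integer $d > 0$, a line bundle $L_d$ on $X$ whose class in $\mathrm{Pic}(X)\otimes\mathbb{Q}$ is that of $L^{\otimes d}$, and, for each $i$, a trivialization $e_i$ of $q_i^* L_d$ on $U_i$. The \emph{tree} of $\Sigma$ has the irreducible components of the $X_i$ as its nodes; the children of a component $V \subseteq X_{i+1}$ are the components $W \subseteq X_i$ such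 that $f_i(W) \subseteq V$. (Its roots are the components of $X_n$; it is a forest if $X$ is reducible.) Let $Z = \bigoplus_{i=0}^{n} \bigoplus_{V} \mathbb{Q}\cdot[V]$, where $V$ runs over the irreducible components of $X_i$. For a component $V$ of $X_{i+1}$ and a child $W$ of $V$, let $m_W \in \mathbb{Z}$ be the multiplicity of $e_{i+1}|_V$, seen as a rational section of $q_{i+1}^* L_d|_V$, at the generic point of $f_i(W)$. Let $c_1(L,\underline{\Sigma})_{[0]}$ and $c_1(L,\underline{\Sigma})_{[1]}$ be the endomorphisms of $Z$ which send $[V]$ to $\sum_{m_W > 0} \frac{m_W}{d}[W]$ and to $\sum_{m_W < 0} \frac{m_W}{d}[W]$ respectively, the sums running over children $W$ of $V$ (both are $0$ if $V$ is a component of $X_0$). Define endomorphisms $c_1(L,\underline{\Sigma})^k_{[l]}$ of $Z$, for $k \in \mathbb{N}$ and $l \in \mathbb{Z}$, by $c_1(L,\underline{\Sigma})^0_{[0]} = \mathrm{id}$, $c_1(L,\underline{\Sigma})^0_{[l]} = 0$ for $l \neq 0$, and \[ c_1(L,\underline{\Sigma})^{k}_{[l]} = c_1(L,\underline{\Sigma})^{k-1}_{[l]}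 \circ c_1(L,\underline{\Sigma})_{[0]} + c_1(L,\underline{\Sigma})^{k-1}_{[l-1]} \circ c_1(L,\underline{\Sigma})_{[1]} \qquad (k \geq 1). \] Let $\deg c_1(L,\underline{\Sigma})^n_{[l]}$ be the degree over $k$ of the $0$-cycle $c_1(L,\underline{\Sigma})^n_{[l]}([X])$, where $[X]$ is the sum of the components of $X_n$, and where the degree of a component $V \cong \mathrm{Spec}\, K$ of $X_0$ is $[K:k]$. A trivialized stratification $\underline{\Sigma}' = (\Sigma', \frac1d \mathbf{e}')$ for $L$, with the same $d$, \emph{refines} $\underline{\Sigma}$ if there is an embedding $\varphi$ of the tree of $\Sigma$ into the tree of $\Sigma'$, which is injective, preserves levels and edges and identifies the roots, and isomorphisms $V \cong \varphi(V)$ over $X$ for all nodes $V$ of the tree of $\Sigma$, compatible with the maps $W \to V$ and $\varphi(W) \to \varphi(V)$ for every child $W$ of $V$, such that the trivializations of $\mathbf{e}$ on $V$ and of $\mathbf{e}'$ on $\varphi(V)$ correspond, where both are defined (for the same line bundle $L_d$, up to a fixed isomorphism). \textbf{Proposition.} If $\underline{\Sigma}$ and $\underline{\Sigma}'$ are trivialized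 stratifications for $L$, and $\underline{\Sigma}'$ refines $\underline{\Sigma}$, then for every $l$ \[ \deg c_1(L,\underline{\Sigma})^n_{[l]} = \deg c_1(L,\underline{\Sigma}')^n_{[l]}. \] -/

import Mathlib

open CategoryTheory AlgebraicGeometry TopologicalSpace

universe u

noncomputable section

namespace TruncatedChern

/-! ### Schemes: finite type over a field, normality, dimension, strata -/

/-- A scheme of finite type over the field `k`. -/
structure AlgScheme (k : Type u) [Field k] where
  /-- The underlying scheme. -/
  X : Scheme.{u}
  /-- The structure morphism. -/
  str : X ⟶ Spec (CommRingCat.of k)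
  locallyOfFiniteType : LocallyOfFiniteType str
  quasiCompact : QuasiCompact str

instance AlgScheme.isNoetherian {k : Type u} [Field k] (X : AlgScheme k) : IsNoetherian X.X :=
  have := X.locallyOfFiniteType
  have := X.quasiCompact
  have : IsLocallyNoetherian X.X := LocallyOfFiniteType.isLocallyNoetherian X.str
  have : CompactSpace X.X := QuasiCompact.compactSpace_of_compactSpace X.str
  { }

/-- A scheme is normal if all its local rings are integrally closed domains. -/
class IsNormal (X : Scheme.{u}) : Prop where
  isDomain (x : X) : IsDomain (X.presheaf.stalk x)
  isIntegrallyClosed (x : X) : IsIntegrallyClosed (X.presheaf.stalk x)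

/-- A scheme has pure dimension `n` if all its irreducible components have dimension `n`. -/
def IsPureDim (X : Scheme.{u}) (n : ℕ) : Prop :=
  ∀ Z ∈ irreducibleComponents X, topologicalKrullDim Z = n

/-- A morphism `f : Y ⟶ X` is birational if it restricts to an isomorphism from a dense open
subscheme of `Y` onto a dense open subscheme of `X`. -/
def IsBirational {Y X : Scheme.{u}} (f : Y ⟶ X) : Prop :=
  ∃ φ : Scheme.PartialIso Y X, φ.iso.hom ≫ φ.target.ι = φ.source.ι ≫ f

/-- The closed immersion `i : D ⟶ X` is (the inclusion of) a reduced Weil divisor: `D` is a reduced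
closed subscheme, all of whose irreducible components have codimension one in `X`. The points `z`
below are the generic points of the components, and the specialization order is such that
`Order.coheight` is the codimension of the closure of a point. The divisor may be zero, i.e. `D`
may be empty. -/
structure IsReducedWeilDivisor {D X : Scheme.{u}} (i : D ⟶ X) : Prop where
  isClosedImmersion : IsClosedImmersion i
  isReduced : IsReduced D
  codim_one : ∀ z : D, closure {z} ∈ irreducibleComponents D → Order.coheight (i z) = 1

/-- A morphism is a stratum if it factors as a proper birational morphism onto a reduced
Weil divisor of the target. (Normality and purity of dimension of the source and target are
part of the definition of a stratification below.) -/
def IsStratum {Y X : Scheme.{u}} (f : Y ⟶ X) : Prop :=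
  ∃ (D : Scheme.{u}) (i : D ⟶ X) (g : Y ⟶ D),
    IsReducedWeilDivisor i ∧ IsProper g ∧ IsBirational g ∧ g ≫ i = f

lemma IsStratum.isProper {Y X : Scheme.{u}} {f : Y ⟶ X} (hf : IsStratum f) : IsProper f := by
  obtain ⟨D, i, g, hi, hg, -, rfl⟩ := hf
  have := hi.isClosedImmersion
  infer_instance

instance IsNormal.isReduced (X : Scheme.{u}) [IsNormal X] : IsReduced X :=
  have (x : X) : _root_.IsReduced (X.presheaf.stalk x) :=
    have := IsNormal.isDomain x
    inferInstance
  isReduced_of_isReduced_stalk X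

/-- Two irreducible components of a normal scheme which meet are equal. -/
lemma IsNormal.eq_of_mem {X : Scheme.{u}} [IsNormal X] {Z W : Set X}
    (hZ : Z ∈ irreducibleComponents X) (hW : W ∈ irreducibleComponents X) {x : X}
    (hxZ : x ∈ Z) (hxW : x ∈ W) : Z = W := by
  have := IsNormal.isDomain x
  let ξ : X := X.fromSpecStalk x (genericPoint (Spec (X.presheaf.stalk x)))
  have key : ∀ T ∈ irreducibleComponents X, x ∈ T → T = closure {ξ} := by
    intro T hT hxT
    have hTc : IsClosed T := isClosed_of_mem_irreducibleComponents T hT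
    have hg : IsGenericPoint hT.1.genericPoint T := by
      have := hT.1.isGenericPoint_genericPoint_closure
      rwa [hTc.closure_eq] at this
    have hs : hT.1.genericPoint ⤳ x := hg.specializes hxT
    have hr : hT.1.genericPoint ∈ Set.range (X.fromSpecStalk x) := by
      rw [Scheme.range_fromSpecStalk]; exact hs
    obtain ⟨y, hy⟩ := hr
    have h1 : ξ ⤳ hT.1.genericPoint := by
      rw [← hy]
      exact (genericPoint_specializes y).map (X.fromSpecStalk x).continuous
    have h2 : T ≤ closure {ξ} := by
      rw [← hg.def]; exact h1.closure_subset
    exact le_antisymm h2 (hT.2 isIrreducible_singleton.closure h2)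
  rw [key Z hZ hxZ, key W hW hxW]

/-- The irreducible components of a normal Noetherian scheme are open. -/
lemma IsNormal.isOpen_of_mem {X : Scheme.{u}} [IsNormal X] [IsNoetherian X] {Z : Set X}
    (hZ : Z ∈ irreducibleComponents X) : IsOpen Z := by
  have h := (X.irreducibleComponentOpen Z).isOpen
  convert h using 1
  ext x
  change x ∈ Z ↔ x ∈ (⋃₀ (irreducibleComponents X \ {Z}))ᶜ
  constructor
  · rintro hx ⟨W, ⟨hW, hne⟩, hxW⟩
    exact hne (IsNormal.eq_of_mem hW hZ hxW hx)
  · intro hx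
    by_contra hxZ
    refine hx ⟨irreducibleComponent x, ⟨irreducibleComponent_mem_irreducibleComponents x, ?_⟩,
      mem_irreducibleComponent⟩
    rintro rfl
    exact hxZ mem_irreducibleComponent

/-! ### Line bundles, `ℚ`-line bundles, sections and trivializations -/

open scoped AlgebraicGeometry

/-- Restriction of a section of an `𝒪_X`-module to a smaller open subset. -/
def res {X : Scheme.{u}} {M : X.Modules} {U V : X.Opens} (h : V ≤ U) (s : Γ(M, U)) : Γ(M, V) :=
  M.presheaf.map (homOfLE h).op s

/-- A section `e` of an `𝒪_X`-module `M` on `U` is a trivialization of `M` on `U` as a line bundle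
if `a ↦ a • e` is an isomorphism from `𝒪_U` to `M|_U`. -/
def IsTrivialization {X : Scheme.{u}} {M : X.Modules} {U : X.Opens} (e : Γ(M, U)) : Prop :=
  ∀ (V : X.Opens) (h : V ≤ U), Function.Bijective fun a : Γ(X, V) ↦ a • res h e

/-- A line bundle is an `𝒪_X`-module which can be trivialized around every point. -/
def IsLineBundle {X : Scheme.{u}} (M : X.Modules) : Prop :=
  ∀ x : X, ∃ (U : X.Opens) (e : Γ(M, U)), x ∈ U ∧ IsTrivialization e

/-- The tensor product of two `𝒪_X`-modules: the sheafification of the presheaf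
`U ↦ M(U) ⊗ N(U)`. -/
def tensor {X : Scheme.{u}} (M N : X.Modules) : X.Modules :=
  (PresheafOfModules.sheafification (𝟙 X.ringCatSheaf.obj)).obj
    (PresheafOfModules.Monoidal.tensorObj (R := X.presheaf) M.val N.val)

/-- The tensor powers of an `𝒪_X`-module. -/
def tensorPow {X : Scheme.{u}} (M : X.Modules) : ℕ → X.Modules
  | 0 => SheafOfModules.unit X.ringCatSheaf
  | m + 1 => tensor (tensorPow M m) M

/-- A `ℚ`-line bundle on `X`, i.e. an element of `Pic(X) ⊗ ℚ`. Any such element is of the form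
`(1 / m) • [M]` for a line bundle `M` and an integer `m > 0`. -/
structure QLineBundle (X : Scheme.{u}) where
  /-- The numerator. -/
  M : X.Modules
  isLineBundle : IsLineBundle M
  /-- The denominator. -/
  m : ℕ
  m_pos : 0 < m

/-- The `d`-th power of the `ℚ`-line bundle `N = (1 / m) • [M]` comes from the line bundle `L`:
the class of `L` equals `(d / m) • [M]` in `Pic(X) ⊗ ℚ`, that is, `L ^ m` and `M ^ d` are isomorphic
up to torsion. -/
def QLineBundle.PowComesFrom {X : Scheme.{u}} (N : QLineBundle X) (d : ℕ) (L : X.Modules) : Prop :=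
  ∃ a : ℕ, 0 < a ∧ Nonempty (tensorPow L (a * N.m) ≅ tensorPow N.M (a * d))

/-- The restriction of a section of `M` along an open immersion. -/
def restrictSection {V X : Scheme.{u}} (j : V ⟶ X) [IsOpenImmersion j] {M : X.Modules}
    {U : X.Opens} (s : Γ(M, U)) : Γ(M.restrict j, j ⁻¹ᵁ U) :=
  (M.restrictAppIso j (j ⁻¹ᵁ U)).inv (res (j.image_preimage_le U) s)

/-- Let `e` be a section on `U` of an `𝒪_V`-module `N` on an integral scheme `V`, seen as a rational
section. The integer `m` is the multiplicity of `e` at `x`, if `e = a • t` on `U ⊓ O` where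
`t` is a trivialization of `N` on a neighbourhood `O` of `x`, and where the function `a`, seen in
the function field of `V`, has order of vanishing `m` at `x`. -/
def IsMultiplicity {V : Scheme.{u}} [IsIntegral V] [IsLocallyNoetherian V] {N : V.Modules}
    {U : V.Opens} (e : Γ(N, U)) (x : V) (m : ℤ) : Prop :=
  ∃ (O : V.Opens) (t : Γ(N, O)) (a : Γ(V, U ⊓ O)) (hη : genericPoint V ∈ U ⊓ O),
    x ∈ O ∧ IsTrivialization t ∧ res inf_le_left e = a • res inf_le_right t ∧
      Scheme.ord (V.presheaf.germ (U ⊓ O) (genericPoint V) hη a) x = m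

open Classical in
/-- The multiplicity at the point `x` of `e`, seen as a rational section of the line bundle `N`;
see `IsMultiplicity`. -/
def multiplicity {V : Scheme.{u}} [IsIntegral V] [IsLocallyNoetherian V] {N : V.Modules}
    {U : V.Opens} (e : Γ(N, U)) (x : V) : ℤ :=
  if h : ∃ m, IsMultiplicity e x m then h.choose else 0

/-! ### Stratifications -/

variable {k : Type u} [Field k]

/-- A stratification `X₀ ⟶ X₁ ⟶ ⋯ ⟶ Xₙ ⟶ X`: the map `q : Xₙ ⟶ X` is proper and birational,
`Xᵢ` is a normal scheme of pure dimension `i`, and all the maps `Xᵢ ⟶ Xᵢ₊₁` are strata. -/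
structure Stratification (X : AlgScheme k) (n : ℕ) where
  /-- The sequence of schemes `X₀ ⟶ X₁ ⟶ ⋯ ⟶ Xₙ`. -/
  chain : ComposableArrows Scheme.{u} n
  /-- The morphism `Xₙ ⟶ X`. -/
  q : chain.obj (Fin.last n) ⟶ X.X
  isNormal (i : Fin (n + 1)) : IsNormal (chain.obj i)
  isPureDim (i : Fin (n + 1)) : IsPureDim (chain.obj i) i
  isProper_q : IsProper q
  isBirational_q : IsBirational q
  isStratum (i : Fin n) : IsStratum (chain.map (homOfLE i.castSucc_le_succ))

namespace Stratification

variable {X : AlgScheme k} {n : ℕ} (S : Stratification X n)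

/-- The scheme `Xᵢ`. -/
abbrev obj (i : Fin (n + 1)) : Scheme.{u} := S.chain.obj i

/-- The stratum `fᵢ : Xᵢ ⟶ Xᵢ₊₁`. -/
abbrev f (i : Fin n) : S.obj i.castSucc ⟶ S.obj i.succ :=
  S.chain.map (homOfLE i.castSucc_le_succ)

/-- The natural map `qᵢ : Xᵢ ⟶ X`. -/
def toBase (i : Fin (n + 1)) : S.obj i ⟶ X.X :=
  S.chain.map (homOfLE i.le_last) ≫ S.q

instance (i : Fin (n + 1)) : IsNormal (S.obj i) := S.isNormal i

instance isProper_f (i : Fin n) : IsProper (S.f i) := (S.isStratum i).isProper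

lemma f_toBase (i : Fin n) : S.f i ≫ S.toBase i.succ = S.toBase i.castSucc := by
  rw [toBase, toBase, ← Category.assoc, ← S.chain.map_comp]
  rfl

instance isProper_toBase (i : Fin (n + 1)) : IsProper (S.toBase i) := by
  induction i using Fin.reverseInduction with
  | last =>
    have := S.isProper_q
    have h : S.chain.map (homOfLE (Fin.le_last (Fin.last n))) = 𝟙 _ := S.chain.map_id _
    rw [toBase, h, Category.id_comp]
    infer_instance
  | cast i hi =>
    rw [← f_toBase]
    infer_instance

instance isNoetherian_obj (i : Fin (n + 1)) : IsNoetherian (S.obj i) :=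
  have : IsLocallyNoetherian (S.obj i) := LocallyOfFiniteType.isLocallyNoetherian (S.toBase i)
  have : CompactSpace (S.obj i) := QuasiCompact.compactSpace_of_compactSpace (S.toBase i)
  { }

/-- The open subset `Uᵢ = Xᵢ ∖ fᵢ₋₁(Xᵢ₋₁)` of `Xᵢ`, with `U₀ = X₀`. -/
def opens : (i : Fin (n + 1)) → (S.obj i).Opens :=
  Fin.cases ⊤ fun i ↦ ⟨(Set.range (S.f i))ᶜ, (S.f i).isClosedMap.isClosed_range.isOpen_compl⟩

/-! #### The associated tree -/

/-- The nodes of level `i` of the tree of a stratification: the irreducible components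
of `Xᵢ`. -/
abbrev Node (i : Fin (n + 1)) : Type u := irreducibleComponents (S.obj i)

instance finite_node (i : Fin (n + 1)) : Finite (S.Node i) :=
  NoetherianSpace.finite_irreducibleComponents.to_subtype

variable {S}

/-- A node, as an open subscheme of `Xᵢ` (the components of `Xᵢ` are open, as `Xᵢ` is normal). -/
def Node.opens {i : Fin (n + 1)} (V : S.Node i) : (S.obj i).Opens :=
  ⟨V.1, IsNormal.isOpen_of_mem V.2⟩

/-- The variety attached to a node of the tree. -/
abbrev Node.scheme {i : Fin (n + 1)} (V : S.Node i) : Scheme.{u} := V.opens.toScheme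

/-- The inclusion of a component in `Xᵢ`. -/
abbrev Node.ι {i : Fin (n + 1)} (V : S.Node i) : V.scheme ⟶ S.obj i := V.opens.ι

instance Node.isIntegral {i : Fin (n + 1)} (V : S.Node i) : IsIntegral V.scheme :=
  have : IrreducibleSpace V.scheme := Subtype.irreducibleSpace V.2.1
  have : IsReduced V.scheme := isReduced_of_isOpenImmersion V.ι
  isIntegral_of_irreducibleSpace_of_isReduced _

/-- The natural map from the variety attached to a node to `X`. -/
def Node.toBase {i : Fin (n + 1)} (V : S.Node i) : V.scheme ⟶ X.X := V.ι ≫ S.toBase i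

/-- The component `W` of `Xᵢ` is a child of the component `V` of `Xᵢ₊₁` if `fᵢ(W) ⊆ V`. -/
def IsChild {i : Fin n} (W : S.Node i.castSucc) (V : S.Node i.succ) : Prop :=
  S.f i '' W.1 ⊆ V.1

/-- The morphism attached to an edge of the tree. -/
def edgeMap {i : Fin n} {W : S.Node i.castSucc} {V : S.Node i.succ} (h : IsChild W V) :
    W.scheme ⟶ V.scheme :=
  IsOpenImmersion.lift V.ι (W.ι ≫ S.f i) (by
    rintro _ ⟨x, rfl⟩
    rw [Scheme.Opens.range_ι]
    exact h ⟨x.1, x.2, rfl⟩)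

end Stratification

open Stratification

/-- A trivialized stratification `(Σ, (1 / d) 𝐞)` for the `ℚ`-line bundle `N` on `X`. -/
structure TrivializedStratification {X : AlgScheme k} (N : QLineBundle X.X) (n : ℕ) extends
    Stratification X n where
  /-- The denominator of the fractional trivialization. -/
  d : ℕ
  d_pos : 0 < d
  /-- A line bundle, from which the `d`-th power of `N` comes. -/
  L : X.X.Modules
  isLineBundle : IsLineBundle L
  powComesFrom : N.PowComesFrom d L
  /-- For each `i`, a trivialization of `qᵢ^* L` on `Uᵢ`. -/
  e (i : Fin (n + 1)) :
    Γ((Scheme.Modules.pullback (toStratification.toBase i)).obj L, toStratification.opens i)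
  isTrivialization (i : Fin (n + 1)) : IsTrivialization (e i)

namespace TrivializedStratification

variable {X : AlgScheme k} {N : QLineBundle X.X} {n : ℕ} (T : TrivializedStratification N n)

/-- The trivialization induced on the component `V` of `Xᵢ`. -/
def nodeSection {i : Fin (n + 1)} (V : T.Node i) :
    Γ(((Scheme.Modules.pullback (T.toBase i)).obj T.L).restrict V.ι, V.ι ⁻¹ᵁ T.opens i) :=
  restrictSection V.ι (T.e i)

/-- The multiplicity `m_W` of the trivialization on the component `V` of `Xᵢ₊₁`, seen as a rational
section, at the generic point of the image of the child `W` of `V`. -/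
def edgeMultiplicity {i : Fin n} {W : T.Node i.castSucc} {V : T.Node i.succ}
    (h : IsChild W V) : ℤ :=
  multiplicity (T.nodeSection V) (edgeMap h (genericPoint W.scheme))

/-- The total cycle group `⨁ᵢ ⨁_{V ⊆ Xᵢ} ℚ • [V]`, where `V` runs over the
irreducible components of `Xᵢ`. -/
abbrev Cycles : Type u := (Σ i : Fin (n + 1), T.Node i) →₀ ℚ

/-- The basis element `[V]` of the total cycle group. -/
abbrev cycle {i : Fin (n + 1)} (V : T.Node i) : T.Cycles := Finsupp.single ⟨i, V⟩ 1

open Classical in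
/-- The cycle `c₁(N, Σ)_[l] ∩ [V]`. It is zero if `V` is a component of `X₀`. If `V` is a component
of `Xᵢ₊₁`, it is the sum of all the `(m_W / d) [W]`, where `W` runs over the children of `V` such
that `m_W > 0` if `l = 0`, resp. such that `m_W < 0` if `l = 1`; it is zero for the other `l`. -/
def chernCycle (l : ℤ) : (i : Fin (n + 1)) → T.Node i → T.Cycles :=
  Fin.cases (fun _ ↦ 0) fun i V ↦ ∑ᶠ W : {W : T.Node i.castSucc // IsChild W V},
    if (l = 0 ∧ 0 < T.edgeMultiplicity W.2) ∨ (l = 1 ∧ T.edgeMultiplicity W.2 < 0) then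
      ((T.edgeMultiplicity W.2 : ℚ) / T.d) • T.cycle W.1
    else 0

/-- The truncated first Chern class `c₁(N, Σ)_[l]`, as an endomorphism of the total
cycle group. -/
def chern (l : ℤ) : Module.End ℚ T.Cycles :=
  Finsupp.linearCombination ℚ fun V ↦ T.chernCycle l V.1 V.2

/-- The truncated powers `c₁(N, Σ)^k_[l]`. -/
def chernPow : ℕ → ℤ → Module.End ℚ T.Cycles
  | 0, l => if l = 0 then LinearMap.id else 0
  | k + 1, l => chernPow k l ∘ₗ T.chern 0 + chernPow k (l - 1) ∘ₗ T.chern 1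

/-- The fundamental cycle `[X]`: the sum of all the components of `Xₙ`. -/
def fundamentalCycle : T.Cycles := ∑ᶠ V : T.Node (Fin.last n), T.cycle V

/-- The degree over `k` of the variety `V` attached to a node: the dimension over `k` of its ring of
functions. If `V` has dimension zero, then `V ≅ Spec K` for a finite extension `K` of `k`, and this
is the degree of `K` over `k`. -/
def nodeDegree {i : Fin (n + 1)} (V : T.Node i) : ℕ :=
  letI : Algebra k Γ(V.scheme, ⊤) :=
    ((Scheme.ΓSpecIso (CommRingCat.of k)).inv ≫ (V.toBase ≫ X.str).appTop).hom.toAlgebra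
  Module.finrank k Γ(V.scheme, ⊤)

/-- The degree map `Z₀ ⟶ ℚ`, extended by zero to the total cycle group. -/
def degree : T.Cycles →ₗ[ℚ] ℚ :=
  Finsupp.linearCombination ℚ fun V ↦ if V.1 = 0 then (T.nodeDegree V.2 : ℚ) else 0

/-- The top truncated Chern number `deg c₁(N, Σ)^n_[l]`. -/
def chernNumber (l : ℤ) : ℚ := T.degree (T.chernPow n l T.fundamentalCycle)

end TrivializedStratification

/-! ### Refinements -/

/-- `S'` is a refinement of `S`, as witnessed by an embedding `φ` of rooted trees, and by isomorphisms
between the varieties attached to the corresponding nodes.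

The condition on the strata, namely that `⨆ V_W ⟶ V` (`W` running over the children of `V`) is
identified with the restriction to a union of components of `⨆ V'_W' ⟶ V'` (`W'` running over the
children of `V' = φ V`), is the conjunction of `map_isChild`, `injective` and `iso_edge`. If `X` is
not irreducible, the tree of `S` is a forest whose roots are the components of `Xₙ`: the embedding
identifies the roots. -/
structure Refinement {X : AlgScheme k} {n : ℕ} (S S' : Stratification X n) where
  /-- The embedding of trees. -/
  φ (i : Fin (n + 1)) : S.Node i → S'.Node i
  injective (i : Fin (n + 1)) : Function.Injective (φ i)
  surjective_root : Function.Surjective (φ (Fin.last n))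
  map_isChild {i : Fin n} {W : S.Node i.castSucc} {V : S.Node i.succ} (h : IsChild W V) :
    IsChild (φ _ W) (φ _ V)
  /-- The isomorphisms between the varieties attached to corresponding nodes. -/
  iso {i : Fin (n + 1)} (V : S.Node i) : V.scheme ≅ (φ i V).scheme
  iso_edge {i : Fin n} {W : S.Node i.castSucc} {V : S.Node i.succ} (h : IsChild W V) :
    edgeMap h ≫ (iso V).hom = (iso W).hom ≫ edgeMap (map_isChild h)
  iso_toBase {i : Fin (n + 1)} (V : S.Node i) : (iso V).hom ≫ (φ i V).toBase = V.toBase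

/-- Let `q : Y ⟶ X` and `q' : Y' ⟶ X` be morphisms, and let `j : V ⟶ Y` and `j' : V ⟶ Y'` be open
immersions inducing the same morphism to `X`. This is the canonical isomorphism
`(q^* L)|_V ≅ (q'^* L')|_V` induced by an isomorphism `L ≅ L'`. -/
def pullbackComparison {V Y Y' X : Scheme.{u}} (j : V ⟶ Y) (q : Y ⟶ X) (j' : V ⟶ Y') (q' : Y' ⟶ X)
    [IsOpenImmersion j] [IsOpenImmersion j'] (h : j ≫ q = j' ≫ q') {L L' : X.Modules}
    (α : L ≅ L') :
    ((Scheme.Modules.pullback q).obj L).restrict j ≅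
      ((Scheme.Modules.pullback q').obj L').restrict j' :=
  (Scheme.Modules.restrictFunctorIsoPullback j).app _ ≪≫
    (Scheme.Modules.pullbackComp j q).app L ≪≫
    (Scheme.Modules.pullbackCongr h).app L ≪≫
    (Scheme.Modules.pullback (j' ≫ q')).mapIso α ≪≫
    ((Scheme.Modules.pullbackComp j' q').app L').symm ≪≫
    ((Scheme.Modules.restrictFunctorIsoPullback j').app _).symm

/-- The trivialized stratification `T' = (Σ', (1 / d) 𝐞')` refines `T = (Σ, (1 / d) 𝐞)`: the
denominators are equal, `Σ'` refines `Σ`, and the trivializations of the same line bundle correspond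
under the isomorphisms between the varieties attached to corresponding nodes, wherever both
are defined. -/
def TrivializedStratification.Refines {X : AlgScheme k} {N : QLineBundle X.X} {n : ℕ}
    (T' T : TrivializedStratification N n) : Prop :=
  T'.d = T.d ∧
  ∃ (R : Refinement T.toStratification T'.toStratification) (α : T.L ≅ T'.L),
    ∀ (i : Fin (n + 1)) (V : T.Node i),
      let j := (R.iso V).hom ≫ (R.φ i V).ι
      (pullbackComparison V.ι (T.toBase i) j (T'.toBase i)
          (by simpa [Node.toBase, j] using (R.iso_toBase V).symm) α).hom.app
          (V.ι ⁻¹ᵁ T.opens i ⊓ j ⁻¹ᵁ T'.opens i) (res inf_le_left (T.nodeSection V)) =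
        res inf_le_right (restrictSection j (T'.e i))

end TruncatedChern

end

noncomputable section

namespace TruncatedChern

open scoped AlgebraicGeometry

/-! ### Invariance of the order of vanishing -/

/-! The embedding of trees induces a linear map `cyclesMap` from the cycles of `T` to those of `T'`,
sending `[V]` to `[φ V]`. The point is that it commutes with both truncated operators `chern 0` and
`chern 1`.

For a child `W` of `V`, the isomorphism `V ≅ φ V` carries the generic point of the image of `W` to
that of `φ W`. It also matches the two trivializations on a dense open subset, so the two
multiplicities agree (`edgeMultiplicity_refinement`).

A child `W'` of `φ V` outside the image of `φ` contributes nothing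
(`edgeMultiplicity_eq_zero_of_notMem_range`). Its image has a generic point of codimension one.
Suppose that the corresponding point of `V` lay in the image of the lower stratum. It would then be
the generic point of the image of some child `W`, and `W' = φ W`, because a stratum is birational
onto its image. So the point lies where the trivialization of `T` generates the line bundle, the
multiplicity is `0`, and `W'` enters neither the positive nor the negative part.

Commutation passes to all `chernPow` by induction. The map preserves the fundamental cycle, since
`φ` is bijective on roots, and it preserves degrees, since the isomorphisms are over `X`. -/

lemma ringOrd_ringEquiv {R S : Type*} [CommRing R] [CommRing S] (σ : R ≃+* S) (x : R) :
    Ring.ord S (σ x) = Ring.ord R x := by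
  let σ' : (R ⧸ Ideal.span {x}) ≃+* (S ⧸ Ideal.span {σ x}) :=
    Ideal.quotientEquiv _ _ σ (by rw [Ideal.map_span, Set.image_singleton]; rfl)
  let := RingHomInvPair.of_ringEquiv σ
  let := RingHomInvPair.symm (σ : R →+* S) (σ.symm : S →+* R)
  let τ : (R ⧸ Ideal.span {x}) ≃ₛₗ[(σ : R →+* S)] (S ⧸ Ideal.span {σ x}) :=
    { σ' with
      map_smul' := fun r y ↦ by
        obtain ⟨y, rfl⟩ := Ideal.Quotient.mk_surjective y
        change σ' (Ideal.Quotient.mk _ (r * y)) = Ideal.Quotient.mk _ (σ r) * σ' (Ideal.Quotient.mk _ y)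
        simp [σ'] }
  apply WithBot.coe_injective
  -- Length is the Krull dimension of the lattice of submodules, and the semilinear equivalence `τ`
  -- identifies the two lattices although the base rings differ.
  rw [Ring.ord, Ring.ord, Module.coe_length, Module.coe_length,
    Order.krullDim_eq_of_orderIso (Submodule.orderIsoMapComap τ)]

/-- By multiplicativity of `Ring.ordFrac` on fractions, it suffices to treat elements of `R`. -/
lemma ordFrac_ringEquiv {R S K L : Type*} [CommRing R] [CommRing S] [IsNoetherianRing R]
    [IsNoetherianRing S] [Ring.KrullDimLE 1 R] [Ring.KrullDimLE 1 S] [Nontrivial R] [Nontrivial S]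
    [Field K] [Field L] [Algebra R K] [Algebra S L] [IsFractionRing R K] [IsFractionRing S L]
    (σ : R ≃+* S) (τ : K →+* L) (h : ∀ x, τ (algebraMap R K x) = algebraMap S L (σ x)) (z : K) :
    Ring.ordFrac S (τ z) = Ring.ordFrac R z := by
  have key (x : R) : Ring.ordFrac S (τ (algebraMap R K x)) = Ring.ordFrac R (algebraMap R K x) := by
    have hR := (FaithfulSMul.algebraMap_injective R K).isDomain
    have hS := (FaithfulSMul.algebraMap_injective S L).isDomain
    by_cases hx : x = 0
    · simp [hx]
    have hx' : σ x ≠ 0 := by simpa using hx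
    rw [h, Ring.ordFrac_eq_ord _ hx, Ring.ordFrac_eq_ord _ hx',
      Ring.ordMonoidWithZeroHom_eq_ord (mem_nonZeroDivisors_of_ne_zero hx),
      Ring.ordMonoidWithZeroHom_eq_ord (mem_nonZeroDivisors_of_ne_zero hx'), ringOrd_ringEquiv]
  obtain ⟨x, y, -, rfl⟩ := IsFractionRing.div_surjective R z
  rw [map_div₀, map_div₀, map_div₀, key, key]

lemma coheight_of_isOpenImmersion {X Y : Scheme.{u}} (f : X ⟶ Y) [IsOpenImmersion f] (x : X) :
    Order.coheight (f x) = Order.coheight x :=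
  f.isOpenEmbedding.coheight_eq

/-- The order of vanishing may be computed on an open subscheme. -/
lemma ord_of_isOpenImmersion {X Y : Scheme.{u}} (f : X ⟶ Y) [IsOpenImmersion f] [IsIntegral X]
    [IsIntegral Y] [IsLocallyNoetherian X] [IsLocallyNoetherian Y] (O : Y.Opens) (a : Γ(Y, O))
    (hη : genericPoint X ∈ f ⁻¹ᵁ O) (hη' : genericPoint Y ∈ O) (x : X) :
    Scheme.ord (X.presheaf.germ (f ⁻¹ᵁ O) (genericPoint X) hη (f.app O a)) x =
      Scheme.ord (Y.presheaf.germ O (genericPoint Y) hη' a) (f x) := by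
  by_cases hx : Order.coheight x = 1
  swap
  -- Outside codimension one, `Scheme.ord` is `0` by convention, and open immersions preserve
  -- codimension.
  · rw [Scheme.ord_eq_zero_of_coheight_neq_one hx, Scheme.ord_eq_zero_of_coheight_neq_one]
    rwa [coheight_of_isOpenImmersion]
  have hx' : Order.coheight (f x) = 1 := by rwa [coheight_of_isOpenImmersion]
  have : Ring.KrullDimLE 1 (X.presheaf.stalk x) := krullDimLE_of_coheight_le hx.le
  have : Ring.KrullDimLE 1 (Y.presheaf.stalk (f x)) := krullDimLE_of_coheight_le hx'.le
  -- The generic point of `X` maps to that of `Y`, but only up to a propositional equality, hence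
  -- the specialization map before the stalk map.
  let τ : Y.functionField ⟶ X.functionField :=
    Y.presheaf.stalkSpecializes (specializes_of_eq (genericPoint_eq_of_isOpenImmersion f)) ≫
      f.stalkMap (genericPoint X)
  have hτ : τ (Y.presheaf.germ O (genericPoint Y) hη' a) =
      X.presheaf.germ (f ⁻¹ᵁ O) (genericPoint X) hη (f.app O a) := by
    have : Y.presheaf.germ O (genericPoint Y) hη' ≫ τ =
        f.app O ≫ X.presheaf.germ (f ⁻¹ᵁ O) (genericPoint X) hη := by
      rw [← Category.assoc, Y.presheaf.germ_stalkSpecializes hη', Scheme.Hom.germ_stalkMap]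
    exact congr($this a)
  rw [Scheme.ord_eq_ordHom_of_coheight_eq_one hx, Scheme.ord_eq_ordHom_of_coheight_eq_one hx',
    ← hτ]
  congr 2
  refine ordFrac_ringEquiv (asIso (f.stalkMap x)).commRingCatIsoToRingEquiv τ.hom (fun y ↦ ?_) _
  have : Y.presheaf.stalkSpecializes (genericPoint_specializes _) ≫ τ =
    f.stalkMap x ≫ X.presheaf.stalkSpecializes (genericPoint_specializes _) := by
      rw [← Scheme.Hom.stalkSpecializes_stalkMap f _ _ (genericPoint_specializes _), ← Category.assoc,
        Y.presheaf.stalkSpecializes_comp]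
  exact congr($this y)

/-! ### Trivializations and multiplicities -/

section Sections

variable {X : Scheme.{u}} {M : X.Modules}

@[simp]
lemma res_res {U V W : X.Opens} (h : V ≤ U) (h' : W ≤ V) (s : Γ(M, U)) :
    res h' (res h s) = res (h'.trans h) s := by
  simp only [res, ← ConcreteCategory.comp_apply, ← Functor.map_comp]
  rfl

@[simp]
lemma res_self {U : X.Opens} (s : Γ(M, U)) : res le_rfl s = s := by
  change M.presheaf.map (𝟙 _) s = s
  simp

lemma res_smul {U V : X.Opens} (h : V ≤ U) (a : Γ(X, U)) (s : Γ(M, U)) :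
    res h (a • s) = X.presheaf.map (homOfLE h).op a • res h s :=
  Scheme.Modules.map_smul M (homOfLE h) a s

lemma app_res {N : X.Modules} (β : M ⟶ N) {U V : X.Opens} (h : V ≤ U) (s : Γ(M, U)) :
    β.app V (res h s) = res h (β.app U s) :=
  congr($(β.mapPresheaf.naturality (homOfLE h).op) s)

lemma IsTrivialization.res {U V : X.Opens} {e : Γ(M, U)} (he : IsTrivialization e) (h : V ≤ U) :
    IsTrivialization (res h e) := by
  intro W hW
  simpa using he W (hW.trans h)

lemma IsTrivialization.exists_smul_eq {U : X.Opens} {e : Γ(M, U)} (he : IsTrivialization e)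
    (s : Γ(M, U)) : ∃ a : Γ(X, U), s = a • e := by
  obtain ⟨a, ha⟩ := (he U le_rfl).2 s
  exact ⟨a, by simpa using ha.symm⟩

lemma IsTrivialization.smul_left_injective {U : X.Opens} {e : Γ(M, U)} (he : IsTrivialization e)
    {a b : Γ(X, U)} (h : a • e = b • e) : a = b :=
  (he U le_rfl).1 (by simpa using h)

/-- Only `e` has to be a generator: writing `t = b • e` gives `e = (a * b) • e`, hence `a * b = 1`.
-/
lemma IsTrivialization.isUnit {U : X.Opens} {e t : Γ(M, U)} (he : IsTrivialization e)
    {a : Γ(X, U)} (h : e = a • t) : IsUnit a := by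
  obtain ⟨b, hb⟩ := he.exists_smul_eq t
  refine IsUnit.of_mul_eq_one b (he.smul_left_injective ?_)
  rw [mul_smul, ← hb, ← h, one_smul]

lemma IsTrivialization.app {N : X.Modules} (β : M ≅ N) {U : X.Opens} {e : Γ(M, U)}
    (he : IsTrivialization e) : IsTrivialization (β.hom.app U e) := by
  intro V h
  have hb : Function.Bijective (β.hom.app V) := ConcreteCategory.bijective_of_isIso (β.hom.app V)
  convert hb.comp (he V h) using 1
  ext a
  simp [← app_res]

end Sections

/-! ### Sections and trivializations under restriction along open immersions -/

section Restriction

variable {X Y Z : Scheme.{u}} {M : Z.Modules}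

/-- Sections of `M.restrict j` on `V` are sections of `M` on `j ''ᵁ V`, with scalars acting through
`(j.appIso V).inv`. The two multiplication maps therefore differ by a bijection of the scalars. -/
lemma isTrivialization_restrict_iff (j : Y ⟶ Z) [IsOpenImmersion j] {O : Y.Opens}
    (t : Γ(M.restrict j, O)) :
    IsTrivialization t ↔ IsTrivialization (M := M) (U := j ''ᵁ O) ((M.restrictAppIso j O).hom t) := by
  have key (V : Y.Opens) (h : V ≤ O) :
      (Function.Bijective fun a : Γ(Y, V) ↦ a • res h t) ↔
        Function.Bijective fun a : Γ(Z, j ''ᵁ V) ↦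
          a • res (M := M) (j.image_mono h) ((M.restrictAppIso j O).hom t) := by
    have hb : Function.Bijective (j.appIso V).inv := ConcreteCategory.bijective_of_isIso _
    rw [← Function.Bijective.of_comp_iff _ hb]
    rfl
  constructor
  · intro ht V h
    -- Every open subset of `j ''ᵁ O` is the image of an open subset of `Y`, so testing on images is
    -- enough.
    obtain ⟨V, rfl⟩ : ∃ V', V = j ''ᵁ V' := ⟨j ⁻¹ᵁ V, by
      rw [j.image_preimage_eq_opensRange_inf, right_eq_inf]
      exact h.trans (j.image_le_opensRange _)⟩
    have h' : V ≤ O := by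
      rw [← j.preimage_image_eq V, ← j.preimage_image_eq O]
      exact j.preimage_mono h
    exact (key V h').1 (ht V h')
  · intro ht V h
    exact (key V h).2 (ht _ _)

lemma IsTrivialization.restrictSection (j : Y ⟶ Z) [IsOpenImmersion j] {U : Z.Opens} {e : Γ(M, U)}
    (he : IsTrivialization e) : IsTrivialization (restrictSection j e) := by
  rw [isTrivialization_restrict_iff]
  exact he.res _

/-- This compares the scalar action on a restriction along `ψ ≫ j` with the one on the restriction
along `j`. -/
lemma appIso_inv_app (ψ : X ⟶ Y) (j : Y ⟶ Z) [IsOpenImmersion ψ] [IsOpenImmersion j]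
    (O : Y.Opens) (a : Γ(Y, O)) (h : (ψ ≫ j) ''ᵁ (ψ ⁻¹ᵁ O) ≤ j ''ᵁ O) :
    ((ψ ≫ j).appIso (ψ ⁻¹ᵁ O)).inv (ψ.app O a) =
      Z.presheaf.map (homOfLE h).op ((j.appIso O).inv a) := by
  have : ψ.app O ≫ ((ψ ≫ j).appIso (ψ ⁻¹ᵁ O)).inv =
      (j.appIso O).inv ≫ Z.presheaf.map (homOfLE h).op := by
    rw [Iso.comp_inv_eq, Category.assoc, Iso.eq_inv_comp]
    rw [Scheme.Hom.appIso_hom', Scheme.Hom.appIso_hom', Scheme.Hom.map_appLE,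
      Scheme.Hom.app_eq_appLE, Scheme.Hom.appLE_comp_appLE]
  exact congr($this a)

end Restriction

/-! ### Multiplicities of rational sections and their invariance -/

section Multiplicity

variable {X Y : Scheme.{u}} [IsIntegral X] [IsLocallyNoetherian X] [IsIntegral Y]
  [IsLocallyNoetherian Y]

lemma IsMultiplicity.eq_zero {N : X.Modules} {U : X.Opens} {e : Γ(N, U)} {x : X} {m : ℤ}
    (h : IsMultiplicity e x m) (he : IsTrivialization e) (hx : x ∈ U) : m = 0 := by
  obtain ⟨O, t, a, hη, hxO, ht, ha, rfl⟩ := h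
  have : Nonempty (U ⊓ O : X.Opens) := ⟨⟨x, hx, hxO⟩⟩
  exact Scheme.ord_of_isUnit ((he.res _).isUnit ha) ⟨hx, hxO⟩

/-- Any witness must be `0`, and so is the default value; existence of a multiplicity plays no role.
-/
lemma multiplicity_eq_zero {N : X.Modules} {U : X.Opens} {e : Γ(N, U)} {x : X}
    (he : IsTrivialization e) (hx : x ∈ U) : multiplicity e x = 0 := by
  unfold multiplicity
  split_ifs with h
  · exact h.choose_spec.eq_zero he hx
  · rfl

open Classical in
-- The chosen value depends only on the predicate, so equivalent predicates give equal
-- multiplicities without any uniqueness statement.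
lemma multiplicity_congr {N : X.Modules} {N' : Y.Modules} {U : X.Opens} {U' : Y.Opens}
    {e : Γ(N, U)} {e' : Γ(N', U')} {x : X} {x' : Y}
    (h : ∀ m, IsMultiplicity e x m ↔ IsMultiplicity e' x' m) :
    multiplicity e x = multiplicity e' x' := by
  have : IsMultiplicity e x = IsMultiplicity e' x' := funext fun m ↦ propext (h m)
  have key (P Q : ℤ → Prop) (hPQ : P = Q) : (if h : ∃ m, P m then h.choose else 0) =
      if h : ∃ m, Q m then h.choose else 0 := by
    subst hPQ
    rfl
  exact key _ _ this

/-- The order depends only on the germ at the generic point, so a rational section may be shrunk to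
any open subset containing that point. -/
lemma isMultiplicity_res_iff {N : X.Modules} {U V : X.Opens} (hV : V ≤ U) (hη : genericPoint X ∈ V)
    (e : Γ(N, U)) (x : X) (m : ℤ) : IsMultiplicity (res hV e) x m ↔ IsMultiplicity e x m := by
  constructor
  · rintro ⟨O, t, a, hηO, hxO, ht, ha, rfl⟩
    -- The function `a` lives only on `V ⊓ O`. As `t` generates on all of `U ⊓ O`, the coefficient
    -- `b` of `e` there extends it.
    obtain ⟨b, hb⟩ := (ht.res (inf_le_right : U ⊓ O ≤ O)).exists_smul_eq (res inf_le_left e)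
    refine ⟨O, t, b, ⟨hV hη, hηO.2⟩, hxO, ht, hb, ?_⟩
    have hle : V ⊓ O ≤ U ⊓ O := inf_le_inf_right _ hV
    have : a = X.presheaf.map (homOfLE hle).op b := by
      apply (ht.res (inf_le_right : V ⊓ O ≤ O)).smul_left_injective
      have := congrArg (res hle) hb
      rw [res_smul, res_res, res_res] at this
      rw [← ha, ← this, res_res]
    rw [this]
    exact congrArg (Scheme.ord · x) (X.presheaf.germ_res_apply (homOfLE hle) _ hηO b).symm
  · rintro ⟨O, t, a, hηO, hxO, ht, ha, rfl⟩
    have hle : V ⊓ O ≤ U ⊓ O := inf_le_inf_right _ hV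
    refine ⟨O, t, X.presheaf.map (homOfLE hle).op a, ⟨hη, hηO.2⟩, hxO, ht, ?_, ?_⟩
    · have := congrArg (res hle) ha
      rwa [res_smul, res_res, res_res, ← res_res hV] at this
    · exact congrArg (Scheme.ord · x) (X.presheaf.germ_res_apply (homOfLE hle) _ ⟨hη, hηO.2⟩ a)

lemma IsMultiplicity.app {M N : X.Modules} (β : M ≅ N) {U : X.Opens} {e : Γ(M, U)} {x : X} {m : ℤ}
    (h : IsMultiplicity e x m) : IsMultiplicity (β.hom.app U e) x m := by
  obtain ⟨O, t, a, hη, hxO, ht, ha, rfl⟩ := h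
  refine ⟨O, β.hom.app O t, a, hη, hxO, ht.app β, ?_, rfl⟩
  rw [← app_res, ha, Scheme.Modules.Hom.app_smul, app_res]

lemma isMultiplicity_app_iff {M N : X.Modules} (β : M ≅ N) {U : X.Opens} (e : Γ(M, U)) (x : X)
    (m : ℤ) : IsMultiplicity (β.hom.app U e) x m ↔ IsMultiplicity e x m := by
  refine ⟨fun h ↦ ?_, fun h ↦ h.app β⟩
  have := h.app β.symm
  rwa [Iso.symm_hom, ← ConcreteCategory.comp_apply, ← Scheme.Modules.Hom.comp_app, β.hom_inv_id,
    Scheme.Modules.Hom.id_app, ConcreteCategory.id_apply] at this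

/-- The neighbourhood, the generator and the function all pull back along `ψ`, and
`ord_of_isOpenImmersion` keeps the order. The computation takes place in `M` on open subsets of `Z`,
where both restrictions have their sections. -/
lemma IsMultiplicity.restrictSection_comp {Z : Scheme.{u}} {M : Z.Modules} {U : Z.Opens}
    {e : Γ(M, U)} (j : X ⟶ Z) (j' : Y ⟶ Z) (ψ : X ⟶ Y) [IsOpenImmersion j] [IsOpenImmersion j']
    [IsOpenImmersion ψ] (hj : ψ ≫ j' = j) {x : X} {m : ℤ}
    (h : IsMultiplicity (restrictSection j' e) (ψ x) m) :
    IsMultiplicity (restrictSection j e) x m := by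
  subst hj
  obtain ⟨O, t, a, hη, hxO, ht, ha, rfl⟩ := h
  have hη' : genericPoint X ∈ ψ ⁻¹ᵁ (j' ⁻¹ᵁ U ⊓ O) := by
    change ψ (genericPoint X) ∈ j' ⁻¹ᵁ U ⊓ O
    rwa [genericPoint_eq_of_isOpenImmersion]
  have hle (O : Y.Opens) : (ψ ≫ j') ''ᵁ (ψ ⁻¹ᵁ O) ≤ j' ''ᵁ O := by
    rw [Scheme.Hom.comp_image]
    exact j'.image_mono (ψ.image_preimage_le _)
  rw [isTrivialization_restrict_iff] at ht
  let t₀ : Γ(M, j' ''ᵁ O) := (M.restrictAppIso j' O).hom t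
  refine ⟨ψ ⁻¹ᵁ O, (M.restrictAppIso (ψ ≫ j') _).inv (res (hle O) t₀), ψ.app _ a, hη', hxO, ?_, ?_,
    ord_of_isOpenImmersion ψ _ a hη' hη x⟩
  · rw [isTrivialization_restrict_iff]
    exact ht.res (hle O)
  · have ha' : res (M := M) ((j'.image_mono inf_le_left).trans (j'.image_preimage_le U)) e =
        (j'.appIso (j' ⁻¹ᵁ U ⊓ O)).inv a • res (M := M) (j'.image_mono inf_le_right) t₀ :=
      (res_res (M := M) (j'.image_preimage_le U) (j'.image_mono inf_le_left) e).symm.trans ha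
    have h := congrArg (res (M := M) (hle (j' ⁻¹ᵁ U ⊓ O))) ha'
    rw [res_smul, res_res, res_res, ← appIso_inv_app ψ j' _ a (hle _)] at h
    have hU : ψ ⁻¹ᵁ (j' ⁻¹ᵁ U ⊓ O) ≤ (ψ ≫ j') ⁻¹ᵁ U := ψ.preimage_mono inf_le_left
    have hO : ψ ⁻¹ᵁ (j' ⁻¹ᵁ U ⊓ O) ≤ ψ ⁻¹ᵁ O := ψ.preimage_mono inf_le_right
    have h' : res (M := M) ((ψ ≫ j').image_mono hU) (res ((ψ ≫ j').image_preimage_le U) e) =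
        ((ψ ≫ j').appIso (ψ ⁻¹ᵁ (j' ⁻¹ᵁ U ⊓ O))).inv (ψ.app _ a) •
          res (M := M) ((ψ ≫ j').image_mono hO) (res (hle O) t₀) := by
      rw [res_res, res_res]
      exact h
    exact h'

lemma isMultiplicity_restrictSection_iff {Z : Scheme.{u}} {M : Z.Modules} {U : Z.Opens}
    (e : Γ(M, U)) (j : X ⟶ Z) (j' : Y ⟶ Z) (ψ : X ≅ Y) [IsOpenImmersion j] [IsOpenImmersion j']
    (hj : ψ.hom ≫ j' = j) (x : X) (m : ℤ) :
    IsMultiplicity (restrictSection j e) x m ↔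
      IsMultiplicity (restrictSection j' e) (ψ.hom x) m := by
  refine ⟨fun h ↦ ?_, fun h ↦ h.restrictSection_comp j j' ψ.hom hj⟩
  refine IsMultiplicity.restrictSection_comp j' j ψ.inv (by simp [← hj]) ?_
  simpa using h

end Multiplicity

/-! ### Generic points and strata -/

/-- Coheight zero means maximal for specialization, that is, having no proper generization. -/
lemma coheight_eq_zero_iff {X : Scheme.{u}} (x : X) :
    Order.coheight x = 0 ↔ closure {x} ∈ irreducibleComponents X := by
  rw [Order.coheight_eq_zero]
  constructor
  · intro hx
    refine ⟨isIrreducible_singleton.closure, fun Z hZ hle ↦ ?_⟩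
    have hg := hZ.isGenericPoint_genericPoint_closure
    have hle' : closure {x} ⊆ closure Z := hle.trans subset_closure
    have h1 : hZ.genericPoint ⤳ x :=
      hg.specializes (hle' (subset_closure rfl))
    have h2 : x ⤳ hZ.genericPoint := hx h1
    calc Z ⊆ closure Z := subset_closure
      _ = closure {hZ.genericPoint} := hg.def.symm
      _ ⊆ closure {x} := h2.closure_subset
  · intro hx y hy
    have hy' : y ⤳ x := hy
    have := hx.2 isIrreducible_singleton.closure hy'.closure_subset
    exact specializes_iff_mem_closure.2 (this (subset_closure rfl))

lemma exists_specializes_coheight_eq_zero {X : Scheme.{u}} (x : X) :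
    ∃ y : X, Order.coheight y = 0 ∧ y ⤳ x := by
  have h := irreducibleComponent_mem_irreducibleComponents x
  let y := genericPoints.ofComponent ⟨_, h⟩
  exact ⟨y.1, (coheight_eq_zero_iff _).2 y.2,
    (genericPoints.isGenericPoint_ofComponent ⟨_, h⟩).specializes mem_irreducibleComponent⟩

lemma eq_of_specializes_of_coheight_eq_one {X : Scheme.{u}} {x y : X} (h : x ⤳ y)
    (hx : Order.coheight x = 1) (hy : Order.coheight y = 1) : x = y := by
  by_contra hne
  have hle : y ≤ x := h
  have hlt : y < x := lt_of_le_not_ge hle fun h' ↦ hne (h.antisymm h').eq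
  have := Order.coheight_add_one_le hlt
  rw [hx, hy] at this
  exact absurd this (by decide)

/-- By normality the component of `y` is open, so `U` meets it; an open set meeting `closure {y}`
contains `y`. -/
lemma IsNormal.mem_of_dense {Y : Scheme.{u}} [IsNormal Y] [IsNoetherian Y] {U : Y.Opens}
    (hU : Dense (U : Set Y)) {y : Y} (hy : Order.coheight y = 0) : y ∈ U := by
  rw [coheight_eq_zero_iff] at hy
  obtain ⟨z, hz, hzU⟩ := hU.inter_open_nonempty _ (IsNormal.isOpen_of_mem hy)
    ⟨y, subset_closure rfl⟩
  exact (specializes_iff_mem_closure.2 hz).mem_open U.isOpen hzU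

/-! ### Birational morphisms and strata at generic points -/

section Birational

variable {Y X : Scheme.{u}} {f : Y ⟶ X}

lemma IsBirational.exists_isOpenImmersion (hf : IsBirational f) :
    ∃ U : Y.Opens, Dense (U : Set Y) ∧ IsOpenImmersion (U.ι ≫ f) := by
  obtain ⟨φ, hφ⟩ := hf
  refine ⟨φ.source, φ.dense_source, ?_⟩
  rw [← hφ]
  infer_instance

variable [IsNormal Y] [IsNoetherian Y]

/-- Near `y` both `Y` and `X` contain the same open subscheme, and codimension can be computed
there. -/
lemma IsBirational.coheight_eq_zero (hf : IsBirational f) {y : Y} (hy : Order.coheight y = 0) :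
    Order.coheight (f y) = 0 := by
  obtain ⟨U, hU, h⟩ := hf.exists_isOpenImmersion
  let z : U := ⟨y, IsNormal.mem_of_dense hU hy⟩
  have h1 := coheight_of_isOpenImmersion (U.ι ≫ f) z
  have h2 := coheight_of_isOpenImmersion U.ι z
  rw [← h2] at h1
  exact h1.trans hy

lemma IsBirational.eq_of_apply_eq (hf : IsBirational f) {y z : Y} (hy : Order.coheight y = 0)
    (hz : Order.coheight z = 0) (h : f y = f z) : y = z := by
  obtain ⟨U, hU, hU'⟩ := hf.exists_isOpenImmersion
  have := (U.ι ≫ f).isOpenEmbedding.injective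
    (a₁ := ⟨y, IsNormal.mem_of_dense hU hy⟩) (a₂ := ⟨z, IsNormal.mem_of_dense hU hz⟩) h
  exact congrArg Subtype.val this

lemma IsStratum.coheight_eq_one (hf : IsStratum f) {y : Y} (hy : Order.coheight y = 0) :
    Order.coheight (f y) = 1 := by
  obtain ⟨D, i, g, hi, -, hg, rfl⟩ := hf
  exact hi.codim_one _ ((coheight_eq_zero_iff _).1 (hg.coheight_eq_zero hy))

lemma IsStratum.eq_of_apply_eq (hf : IsStratum f) {y z : Y} (hy : Order.coheight y = 0)
    (hz : Order.coheight z = 0) (h : f y = f z) : y = z := by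
  obtain ⟨D, i, g, hi, -, hg, rfl⟩ := hf
  have := hi.isClosedImmersion
  exact hg.eq_of_apply_eq hy hz (i.isClosedEmbedding.injective h)

/-- Any point is a specialization of a generic point `z`, and `f z` already has codimension one;
specializing can only increase the codimension. -/
lemma IsStratum.coheight_ne_zero (hf : IsStratum f) (y : Y) : Order.coheight (f y) ≠ 0 := by
  intro h
  obtain ⟨z, hz, hzy⟩ := exists_specializes_coheight_eq_zero y
  have h1 := hf.coheight_eq_one hz
  have h2 : f y ≤ f z := hzy.map f.continuous
  have := Order.coheight_anti h2
  rw [h1, h] at this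
  exact absurd this (by decide)

end Birational

/-! ### Generic points of nodes -/

namespace Stratification

variable {k : Type u} [Field k] {X : AlgScheme k} {n : ℕ} {S S' : Stratification X n}

/-- The generic point of a node, as a point of `Xᵢ`. -/
def Node.gen {i : Fin (n + 1)} (V : S.Node i) : S.obj i := V.ι (genericPoint V.scheme)

lemma Node.isGenericPoint_gen {i : Fin (n + 1)} (V : S.Node i) : IsGenericPoint V.gen V.1 := by
  have h := (genericPoint_spec V.scheme).image V.ι.continuous
  have hV : V.ι '' Set.univ = V.1 := by
    rw [Set.image_univ, Scheme.Opens.range_ι]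
    rfl
  rw [hV, (isClosed_of_mem_irreducibleComponents _ V.2).closure_eq] at h
  exact h

lemma Node.coheight_gen {i : Fin (n + 1)} (V : S.Node i) : Order.coheight V.gen = 0 := by
  rw [coheight_eq_zero_iff, V.isGenericPoint_gen.def]
  exact V.2

lemma Node.eq_of_gen_eq {i : Fin (n + 1)} {V W : S.Node i} (h : V.gen = W.gen) : V = W := by
  apply Subtype.ext
  rw [← V.isGenericPoint_gen.def, h, W.isGenericPoint_gen.def]

lemma Node.eq_of_mem {i : Fin (n + 1)} {V W : S.Node i} {x : S.obj i} (hV : x ∈ V.1)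
    (hW : x ∈ W.1) : V = W :=
  Subtype.ext (IsNormal.eq_of_mem V.2 W.2 hV hW)

lemma Node.exists_mem {i : Fin (n + 1)} (x : S.obj i) : ∃ V : S.Node i, x ∈ V.1 :=
  ⟨⟨_, irreducibleComponent_mem_irreducibleComponents x⟩, mem_irreducibleComponent⟩

/-- One point suffices because `V` is open and closed: openness puts the image of the generic point
of `W` in `V`, and closedness then puts all of `W` there. -/
lemma isChild_of_mem {i : Fin n} {W : S.Node i.castSucc} {V : S.Node i.succ} {x : S.obj i.castSucc}
    (hxW : x ∈ W.1) (hxV : S.f i x ∈ V.1) : IsChild W V := by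
  have hgen : S.f i W.gen ∈ V.1 :=
    ((W.isGenericPoint_gen.specializes hxW).map (S.f i).continuous).mem_open V.opens.isOpen hxV
  rintro _ ⟨y, hy, rfl⟩
  exact ((W.isGenericPoint_gen.specializes hy).map (S.f i).continuous).mem_closed
    (isClosed_of_mem_irreducibleComponents _ V.2) hgen

lemma exists_parent {i : Fin n} (W : S.Node i.castSucc) : ∃ V : S.Node i.succ, IsChild W V := by
  obtain ⟨V, hV⟩ := Node.exists_mem (S.f i W.gen)
  exact ⟨V, isChild_of_mem W.isGenericPoint_gen.mem hV⟩

lemma IsChild.parent_eq {i : Fin n} {W : S.Node i.castSucc} {V V' : S.Node i.succ}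
    (h : IsChild W V) (h' : IsChild W V') : V = V' :=
  Node.eq_of_mem (h ⟨_, W.isGenericPoint_gen.mem, rfl⟩) (h' ⟨_, W.isGenericPoint_gen.mem, rfl⟩)

lemma edgeMap_ι {i : Fin n} {W : S.Node i.castSucc} {V : S.Node i.succ} (h : IsChild W V) :
    edgeMap h ≫ V.ι = W.ι ≫ S.f i :=
  IsOpenImmersion.lift_fac _ _ _

lemma ι_edgeMap_genericPoint {i : Fin n} {W : S.Node i.castSucc} {V : S.Node i.succ}
    (h : IsChild W V) : V.ι (edgeMap h (genericPoint W.scheme)) = S.f i W.gen :=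
  congr($(edgeMap_ι h) (genericPoint W.scheme))

lemma coheight_edgeMap_genericPoint {i : Fin n} {W : S.Node i.castSucc} {V : S.Node i.succ}
    (h : IsChild W V) : Order.coheight (edgeMap h (genericPoint W.scheme)) = 1 := by
  rw [← coheight_of_isOpenImmersion V.ι, ι_edgeMap_genericPoint]
  exact (S.isStratum i).coheight_eq_one W.coheight_gen

lemma edgeMap_genericPoint_injective {i : Fin n} {W W' : S.Node i.castSucc} {V : S.Node i.succ}
    (h : IsChild W V) (h' : IsChild W' V)
    (heq : edgeMap h (genericPoint W.scheme) = edgeMap h' (genericPoint W'.scheme)) : W = W' := by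
  apply Node.eq_of_gen_eq
  apply (S.isStratum i).eq_of_apply_eq W.coheight_gen W'.coheight_gen
  rw [← ι_edgeMap_genericPoint h, ← ι_edgeMap_genericPoint h', heq]

/-- This makes the trivialization on each component a rational section. -/
lemma gen_mem_opens {i : Fin (n + 1)} (V : S.Node i) : V.gen ∈ S.opens i := by
  induction i using Fin.cases with
  | zero => trivial
  | succ i =>
    rintro ⟨y, hy⟩
    exact (S.isStratum i).coheight_ne_zero y (hy ▸ V.coheight_gen)

/-- If a point of codimension one of a node lies on the image of the lower stratum, then it is the
generic point of the image of a child. -/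
lemma exists_isChild_of_notMem_opens {i : Fin n} {V : S.Node i.succ} {x : V.scheme}
    (hx : Order.coheight x = 1) (hxU : V.ι x ∉ S.opens i.succ) :
    ∃ (W : S.Node i.castSucc) (h : IsChild W V), edgeMap h (genericPoint W.scheme) = x := by
  obtain ⟨y, hy⟩ : V.ι x ∈ Set.range (S.f i) := not_not.1 hxU
  obtain ⟨W, hW⟩ := Node.exists_mem y
  have h : IsChild W V := isChild_of_mem hW (hy ▸ x.2)
  refine ⟨W, h, V.ι.isOpenEmbedding.injective ?_⟩
  rw [ι_edgeMap_genericPoint]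
  -- The image of the generic point of `W` specializes to `x`, and both have codimension one.
  apply eq_of_specializes_of_coheight_eq_one
  · rw [← hy]
    exact (W.isGenericPoint_gen.specializes hW).map (S.f i).continuous
  · exact (S.isStratum i).coheight_eq_one W.coheight_gen
  · rwa [coheight_of_isOpenImmersion]

end Stratification

open Stratification

/-! ### Children of corresponding nodes in a refinement -/

namespace Refinement

variable {k : Type u} [Field k] {X : AlgScheme k} {n : ℕ} {S S' : Stratification X n}
  (R : Refinement S S')

/-- The converse uses uniqueness of parents: `W` has some parent `V'`, so `φ V'` and `φ V` are both
parents of `φ W`, and `φ` is injective. -/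
lemma isChild_iff {i : Fin n} {W : S.Node i.castSucc} {V : S.Node i.succ} :
    IsChild (R.φ _ W) (R.φ _ V) ↔ IsChild W V := by
  refine ⟨fun h ↦ ?_, R.map_isChild⟩
  obtain ⟨V', hV'⟩ := exists_parent W
  rwa [← R.injective _ ((R.map_isChild hV').parent_eq h)]

lemma iso_edgeMap_genericPoint {i : Fin n} {W : S.Node i.castSucc} {V : S.Node i.succ}
    (h : IsChild W V) : (R.iso V).hom (edgeMap h (genericPoint W.scheme)) =
      edgeMap (R.map_isChild h) (genericPoint (R.φ _ W).scheme) := by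
  rw [← genericPoint_eq_of_isOpenImmersion (R.iso W).hom]
  exact congr($(R.iso_edge h) (genericPoint W.scheme))

/-- The additional children in a refinement meet the stratification in its open part. -/
lemma ι_iso_inv_mem_opens {i : Fin n} {V : S.Node i.succ} {W' : S'.Node i.castSucc}
    (h : IsChild W' (R.φ _ V)) (hW' : W' ∉ Set.range (R.φ i.castSucc)) :
    V.ι ((R.iso V).inv (edgeMap h (genericPoint W'.scheme))) ∈ S.opens i.succ := by
  by_contra hx
  obtain ⟨W, hW, hWx⟩ := exists_isChild_of_notMem_opens
    ((coheight_of_isOpenImmersion _ _).trans (coheight_edgeMap_genericPoint h)) hx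
  -- Children of `φ V` are determined by the generic points of their images, and `φ W` and `W'`
  -- share this point.
  refine hW' ⟨W, edgeMap_genericPoint_injective (R.map_isChild hW) h ?_⟩
  rw [← R.iso_edgeMap_genericPoint hW, hWx]
  simp

end Refinement

/-! ### Truncated Chern numbers and refinements -/

lemma finrank_globalSections_congr {k : Type u} [Field k] {V W : Scheme.{u}}
    (f : V ⟶ Spec (CommRingCat.of k)) (g : W ⟶ Spec (CommRingCat.of k)) (ψ : V ≅ W)
    (h : ψ.hom ≫ g = f) :
    letI : Algebra k Γ(V, ⊤) := ((Scheme.ΓSpecIso (CommRingCat.of k)).inv ≫ f.appTop).hom.toAlgebra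
    letI : Algebra k Γ(W, ⊤) := ((Scheme.ΓSpecIso (CommRingCat.of k)).inv ≫ g.appTop).hom.toAlgebra
    Module.finrank k Γ(V, ⊤) = Module.finrank k Γ(W, ⊤) := by
  let : Algebra k Γ(V, ⊤) := ((Scheme.ΓSpecIso (CommRingCat.of k)).inv ≫ f.appTop).hom.toAlgebra
  let : Algebra k Γ(W, ⊤) := ((Scheme.ΓSpecIso (CommRingCat.of k)).inv ≫ g.appTop).hom.toAlgebra
  have : IsIso ψ.hom.appTop := inferInstanceAs (IsIso (ψ.hom.app ⊤))
  let σ : Γ(W, ⊤) ≃+* Γ(V, ⊤) := (asIso ψ.hom.appTop).commRingCatIsoToRingEquiv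
  have hσ (a : k) : σ (algebraMap k Γ(W, ⊤) a) = algebraMap k Γ(V, ⊤) a := by
    have : ((Scheme.ΓSpecIso (CommRingCat.of k)).inv ≫ g.appTop) ≫ ψ.hom.appTop =
        (Scheme.ΓSpecIso (CommRingCat.of k)).inv ≫ f.appTop := by
      rw [Category.assoc, ← Scheme.Hom.comp_appTop, h]
    exact congr($this a)
  exact (AlgEquiv.ofRingEquiv (f := σ) hσ).toLinearEquiv.finrank_eq.symm

namespace TrivializedStratification

variable {k : Type u} [Field k] {X : AlgScheme k} {N : QLineBundle X.X} {n : ℕ}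
  {T T' : TrivializedStratification N n} (R : Refinement T.toStratification T'.toStratification)

lemma nodeDegree_refinement {i : Fin (n + 1)} (V : T.Node i) :
    T'.nodeDegree (R.φ i V) = T.nodeDegree V :=
  (finrank_globalSections_congr _ _ (R.iso V) (by
    rw [← Category.assoc, R.iso_toBase V])).symm

lemma isTrivialization_nodeSection {i : Fin (n + 1)} (V : T.Node i) :
    IsTrivialization (T.nodeSection V) :=
  (T.isTrivialization i).restrictSection V.ι

/-- The trivializations of a stratification and of a refinement correspond, under the given
isomorphism between the line bundles. -/
def Compatible (α : T.L ≅ T'.L) : Prop :=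
  ∀ (i : Fin (n + 1)) (V : T.Node i),
    let j := (R.iso V).hom ≫ (R.φ i V).ι
    (pullbackComparison V.ι (T.toBase i) j (T'.toBase i)
        (by simpa [Node.toBase, j] using (R.iso_toBase V).symm) α).hom.app
        (V.ι ⁻¹ᵁ T.opens i ⊓ j ⁻¹ᵁ T'.opens i) (res inf_le_left (T.nodeSection V)) =
      res inf_le_right (restrictSection j (T'.e i))

variable {R} {α : T.L ≅ T'.L}

/-- This is needed at every point `x`, not only at images of children of `V`, in order to treat the
additional children in `T'`. -/
lemma multiplicity_refinement (h : Compatible R α) {i : Fin (n + 1)} (V : T.Node i)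
    (x : V.scheme) :
    multiplicity (T'.nodeSection (R.φ i V)) ((R.iso V).hom x) =
      multiplicity (T.nodeSection V) x := by
  refine multiplicity_congr fun m ↦ ?_
  have h1 : genericPoint V.scheme ∈ V.ι ⁻¹ᵁ T.opens i := gen_mem_opens V
  have h2 : genericPoint V.scheme ∈ ((R.iso V).hom ≫ (R.φ i V).ι) ⁻¹ᵁ T'.opens i := by
    change (R.φ i V).ι ((R.iso V).hom (genericPoint V.scheme)) ∈ T'.opens i
    rw [genericPoint_eq_of_isOpenImmersion (R.iso V).hom]
    exact gen_mem_opens (R.φ i V)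
  -- The section of `T'` is moved to `V`, shrunk to the common domain, identified with the section
  -- of `T` through the comparison isomorphism, and enlarged again.
  rw [nodeSection, ← isMultiplicity_restrictSection_iff (T'.e i) _ _ (R.iso V) rfl,
    ← isMultiplicity_res_iff (inf_le_right : V.ι ⁻¹ᵁ T.opens i ⊓ _ ≤ _) ⟨h1, h2⟩, ← h i V,
    isMultiplicity_app_iff, isMultiplicity_res_iff inf_le_left ⟨h1, h2⟩]

lemma edgeMultiplicity_refinement (h : Compatible R α) {i : Fin n} {W : T.Node i.castSucc}
    {V : T.Node i.succ} (hW : IsChild W V) :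
    T'.edgeMultiplicity (R.map_isChild hW) = T.edgeMultiplicity hW := by
  rw [edgeMultiplicity, edgeMultiplicity, ← R.iso_edgeMap_genericPoint hW,
    multiplicity_refinement h]

lemma edgeMultiplicity_eq_zero_of_notMem_range (h : Compatible R α) {i : Fin n}
    {V : T.Node i.succ} {W' : T'.Node i.castSucc} (hW' : IsChild W' (R.φ _ V))
    (hr : W' ∉ Set.range (R.φ i.castSucc)) : T'.edgeMultiplicity hW' = 0 := by
  let x := (R.iso V).inv (edgeMap hW' (genericPoint W'.scheme))
  have hx : (R.iso V).hom x = edgeMap hW' (genericPoint W'.scheme) := by simp [x]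
  rw [edgeMultiplicity, ← hx, multiplicity_refinement h]
  exact multiplicity_eq_zero (isTrivialization_nodeSection V) (R.ι_iso_inv_mem_opens hW' hr)

variable (R) in
/-- The map between total cycle groups induced by a refinement. -/
def cyclesMap : T.Cycles →ₗ[ℚ] T'.Cycles :=
  Finsupp.lmapDomain ℚ ℚ fun V ↦ ⟨V.1, R.φ V.1 V.2⟩

lemma cyclesMap_single {i : Fin (n + 1)} (V : T.Node i) (a : ℚ) :
    cyclesMap R (Finsupp.single ⟨i, V⟩ a) = Finsupp.single ⟨i, R.φ i V⟩ a :=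
  Finsupp.mapDomain_single

lemma cyclesMap_chernCycle (h : Compatible R α) (hd : T'.d = T.d) (l : ℤ) (i : Fin (n + 1))
    (V : T.Node i) : cyclesMap R (T.chernCycle l i V) = T'.chernCycle l i (R.φ i V) := by
  classical
  induction i using Fin.cases with
  | zero => exact map_zero _
  | succ i =>
    let g (W : {W : T.Node i.castSucc // IsChild W V}) :
        {W : T'.Node i.castSucc // IsChild W (R.φ _ V)} := ⟨R.φ _ W.1, R.map_isChild W.2⟩
    have hg : Function.Injective g := fun W W' hW ↦
      Subtype.ext (R.injective _ (congrArg Subtype.val hW))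
    change (cyclesMap R).toAddMonoidHom (∑ᶠ W : {W : T.Node i.castSucc // IsChild W V},
        if (l = 0 ∧ 0 < T.edgeMultiplicity W.2) ∨ (l = 1 ∧ T.edgeMultiplicity W.2 < 0) then
          ((T.edgeMultiplicity W.2 : ℚ) / T.d) • T.cycle W.1 else 0) =
      ∑ᶠ W : {W : T'.Node i.castSucc // IsChild W (R.φ _ V)},
        if (l = 0 ∧ 0 < T'.edgeMultiplicity W.2) ∨ (l = 1 ∧ T'.edgeMultiplicity W.2 < 0) then
          ((T'.edgeMultiplicity W.2 : ℚ) / T'.d) • T'.cycle W.1 else 0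
    -- The sum over the children of `φ V` is cut down to the range of `g`; the terms outside it
    -- vanish.
    rw [AddMonoidHom.map_finsum _ (Set.toFinite _), ← finsum_mem_univ (α := Subtype fun W : T'.Node i.castSucc ↦ _),
      ← finsum_mem_inter_support_eq' _ (Set.range g) Set.univ, finsum_mem_range hg]
    · refine finsum_congr fun W ↦ ?_
      have hm : T'.edgeMultiplicity (g W).2 = T.edgeMultiplicity W.2 :=
        edgeMultiplicity_refinement h W.2
      rw [hm, hd, LinearMap.toAddMonoidHom_coe, apply_ite (cyclesMap R), map_zero, map_smul,
        cycle, cyclesMap_single]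
    · intro W' hW'
      simp only [Set.mem_univ, iff_true]
      by_contra hr
      refine hW' ?_
      have : T'.edgeMultiplicity W'.2 = 0 := by
        refine edgeMultiplicity_eq_zero_of_notMem_range h W'.2 ?_
        rintro ⟨W, hW⟩
        exact hr ⟨⟨W, R.isChild_iff.1 (hW ▸ W'.2)⟩, Subtype.ext hW⟩
      -- Multiplicity zero fails both strict sign conditions, so the summand is `0` for every `l`.
      simp [this]

lemma cyclesMap_comp_chern (h : Compatible R α) (hd : T'.d = T.d) (l : ℤ) :
    cyclesMap R ∘ₗ T.chern l = T'.chern l ∘ₗ cyclesMap R := by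
  refine Finsupp.lhom_ext fun ⟨i, V⟩ a ↦ ?_
  simp [chern, cyclesMap_single, cyclesMap_chernCycle h hd]

lemma cyclesMap_comp_chernPow (h : Compatible R α) (hd : T'.d = T.d) (m : ℕ) (l : ℤ) :
    cyclesMap R ∘ₗ T.chernPow m l = T'.chernPow m l ∘ₗ cyclesMap R := by
  induction m generalizing l with
  | zero =>
    simp only [chernPow]
    split_ifs <;> rfl
  | succ m ih =>
    simp only [chernPow, LinearMap.comp_add, LinearMap.add_comp, ← LinearMap.comp_assoc, ih]
    simp only [LinearMap.comp_assoc, cyclesMap_comp_chern h hd]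

lemma cyclesMap_fundamentalCycle : cyclesMap R T.fundamentalCycle = T'.fundamentalCycle := by
  change (cyclesMap R).toAddMonoidHom _ = _
  rw [fundamentalCycle, AddMonoidHom.map_finsum _ (Set.toFinite _)]
  exact finsum_eq_of_bijective _ ⟨R.injective _, R.surjective_root⟩ fun V ↦ cyclesMap_single V 1

lemma degree_comp_cyclesMap : T'.degree ∘ₗ cyclesMap R = T.degree := by
  ext ⟨i, V⟩
  simp [degree, cyclesMap_single, nodeDegree_refinement]

lemma chernNumber_eq_of_compatible (h : Compatible R α) (hd : T'.d = T.d) (l : ℤ) :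
    T.chernNumber l = T'.chernNumber l := by
  rw [chernNumber, ← degree_comp_cyclesMap (R := R), LinearMap.comp_apply,
    ← LinearMap.comp_apply (cyclesMap R), cyclesMap_comp_chernPow h hd, LinearMap.comp_apply,
    cyclesMap_fundamentalCycle, chernNumber]

end TrivializedStratification

end TruncatedChern

end

theorem mainTheorem7 {k : Type u} [Field k] (n : ℕ) (X : TruncatedChern.AlgScheme k)
    [AlgebraicGeometry.IsReduced X.X] (hX : TruncatedChern.IsPureDim X.X n)
    (N : TruncatedChern.QLineBundle X.X) (T T' : TruncatedChern.TrivializedStratification N n)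
    (h : T'.Refines T) (l : ℤ) :
    T.chernNumber l = T'.chernNumber l := by
  obtain ⟨hd, R, α, hα⟩ := h
  exact TruncatedChern.TrivializedStratification.chernNumber_eq_of_compatible (R := R) hα hd l
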